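/- Let $(X,d)$ be a metric space, $f_n:X\to X$ ($n\ge 0$) maps, and consider the non-autonomous system $x_{n+1}=f_n(x_n)$. Put $f_i^0=\mathrm{id}$, $f_i^n=f_{i+n-1}\circ\cdots\circ f_i$. Let $N\ge 2$ and let $A=(a_{ij})_{N\times N}$ be a transition matrix, i.e. a $0$–$1$ matrix with no zero row and no zero column. Let $\Sigma_N^+(A)=\{\alpha=(a_0,a_1,\dots): 1\le a_j\le N,\ \text{ the } (a_j,a_{j+1})\text{ entry of } A \text{ is } 1 \text{ for all } j\ge0\}$ with the metric $\hat\rho(\alpha,\beta)=\sum_{i\ge0}\hat d(a_i,b_i)2^{-i}$, where $\hat d(a,b)=0$ if $a=b$ and $1$ otherwise, let $\sigma_A$ be the shift on $\Sigma_N^+(A)$, and let $\rho(A)=\lim_{n\to\infty}\|A^n\|^{1/n}$, where $\|B\|$ is the sum of the entries of $B$. Let $V_1,\dots,V_N$ be nonempty subsets of $X$ with $d(V_i,V_j)=\inf\{d(a,b):a\in V_i,b\in V_j\}>0$ for $i\ne j$, and for $1\le i\le N$, $n\ge0$ let $V_{i,n}\subset V_i$ be nonempty and compact. Put $E=\bigcup_{n\ge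 0}\bigcup_{i=1}^N V_{i,n}$ and, for $\alpha=(a_0,a_1,\dots)\in\Sigma_N^+(A)$, $V_\alpha^{m,n}=\bigcap_{k=0}^m (f_n^{k})^{-1}(V_{a_k,n+k})$. Assume: - $\{f_n\}$ is equi-continuous in $E$: for every $\epsilon>0$ there is $\delta>0$ such that $d(f_n(x),f_n(y))<\epsilon$ for all $n\ge0$ and all $x,y\in E$ with $d(x,y)<\delta$; - $(\mathbf{H_1})$ $V_\alpha^{m,n}\ne\emptyset$ for all $m,n\ge0$ and $\alpha\in\Sigma_N^+(A)$; - $(\mathbf{H_2})$ for every $\alpha\in\Sigma_N^+(A)$, the diameter of $V_\alpha^{m,n}$ tends to $0$ as $m\to\infty$, uniformly in $n\ge0$. Then there are nonempty compact sets $\Lambda_n\subset\bigcup_{i=1}^N V_{i,n}$ ($n\ge0$) with $f_n(\Lambda_n)=\Lambda_{n+1}$ such that the subsystem on $\{\Lambda_n\}$ is topologically equi-conjugate to $(\Sigma_N^+(A),\sigma_A)$: there are bijections $h_n:\Lambda_n\to\Sigma_N^+(A)$ with $h_{n+1}\circ f_n=\sigma_A\circ h_n$ on $\Lambda_n$ such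 that $\{h_n\}_{n\ge0}$ and $\{h_n^{-1}\}_{n\ge0}$ are both equi-continuous (for every $\epsilon$ one $\delta$ serves all $n$). Moreover, if $X$ is compact, then $h(f_{0,\infty},\Lambda_0)=\log\rho(A)$ (the limit $\rho(A)$ exists and is positive). Here, for nonempty $Y\subset X$, $h(f_{0,\infty},Y)=\sup_{\mathcal A}\limsup_{n\to\infty}\frac1n\log\mathcal N(\mathcal A_0^n|_Y)$, where $\mathcal A$ runs over the open covers of $X$, $\mathcal A_0^n=\{\bigcap_{j=0}^{n-1}(f_0^{j})^{-1}(A_j): A_j\in\mathcal A\}$, $\mathcal A_0^n|_Y=\{B\cap Y:B\in\mathcal A_0^n\}$, and $\mathcal N$ denotes the minimal cardinality of a subcover of $Y$. Further, suppose that $A$ is irreducible (for all $i,j$ there is $k\ge1$ with $(A^k)_{ij}>0$) and $\sum_{j=1}^N a_{i_0j}\ge2$ for some $i_0$. Then: - the system is Li–Yorke $\delta$-chaotic for some $\delta>0$: there is an uncountable $S\subset X$ such that for all distinct $x,y\in S$, $\liminf_{n\to\infty} d(f_0^n(x),f_0^n(y))=0$ and $\limsup_{n\to\infty} d(f_0^n(x),f_0^n(y))>\delta$;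 - the system is distributionally chaotic: there is an uncountable $D\subset X$ such that for all distinct $x,y\in D$, $\limsup_{n\to\infty}\frac1n\#\{0\le i<n: d(f_0^i(x),f_0^i(y))<\epsilon\}=1$ for every $\epsilon>0$, and $\liminf_{n\to\infty}\frac1n\#\{0\le i<n: d(f_0^i(x),f_0^i(y))<\delta\}=0$ for some $\delta>0$. -/

import Mathlib

open Set Filter Topology
open scoped ENNReal

noncomputable section

namespace NDS

/-! ### Non-autonomous discrete systems -/

section Systems

variable {X : Type*}

/-- `iter f i n` is the map `f_i^n = f_{i+n-1} ∘ ⋯ ∘ f_i`, with `f_i^0 = id`. -/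
def iter (f : ℕ → X → X) (i : ℕ) : ℕ → X → X
  | 0 => id
  | n + 1 => f (i + n) ∘ iter f i n

/-- The sequence of subsets `Λ n` is invariant under `x_{n+1} = f_n(x_n)`. -/
def IsInvariantSeq (f : ℕ → X → X) (Λ : ℕ → Set X) : Prop :=
  ∀ n, MapsTo (f n) (Λ n) (Λ (n + 1))

/-- The distance `inf {d(a,b) : a ∈ A, b ∈ B}` between two (nonempty) subsets. -/
def setDist [MetricSpace X] (A B : Set X) : ℝ :=
  sInf (image2 (fun a b => dist a b) A B)

end Systems

/-- A sequence of maps `h n : S n → T n` between metric spaces is equi-continuous: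
one `δ` serves all `n` and all pairs of points. -/
def EquiContinuous {S T : ℕ → Type*} [∀ n, MetricSpace (S n)] [∀ n, MetricSpace (T n)]
    (h : ∀ n, S n → T n) : Prop :=
  ∀ ε : ℝ, 0 < ε → ∃ δ : ℝ, 0 < δ ∧
    ∀ (n : ℕ) (x y : S n), dist x y < δ → dist (h n x) (h n y) < ε

/-- The invariant subsystem of `x_{n+1} = f_n(x_n)` on `Λ` is topologically equi-conjugate to the
invariant subsystem of `u_{n+1} = g_n(u_n)` on `E`: there are bijections `h n : Λ n → E n`
with `h_{n+1} ∘ f_n = g_n ∘ h_n`, such that both `{h_n}` and `{h_n⁻¹}` are equi-continuous. -/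
def EquiConjugate {X Y : Type*} [MetricSpace X] [MetricSpace Y]
    (f : ℕ → X → X) (Λ : ℕ → Set X) (g : ℕ → Y → Y) (E : ℕ → Set Y) : Prop :=
  ∃ (hΛ : IsInvariantSeq f Λ) (hE : IsInvariantSeq g E) (h : ∀ n, Λ n ≃ E n),
    EquiContinuous (fun n => (h n : Λ n → E n)) ∧
    EquiContinuous (fun n => ((h n).symm : E n → Λ n)) ∧
    ∀ (n : ℕ) (x : Λ n),
      h (n + 1) ((hΛ n).restrict (f n) (Λ n) (Λ (n + 1)) x) =
        (hE n).restrict (g n) (E n) (E (n + 1)) (h n x)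

/-! ### Chaos -/

section Chaos

variable {X : Type*} [MetricSpace X]

/-- `S` is a Li–Yorke `δ`-scrambled set. The limits are taken in `[0,∞]`, since orbits may be
unbounded. -/
def IsLiYorkeScrambled (f : ℕ → X → X) (δ : ℝ) (S : Set X) : Prop :=
  ∀ x ∈ S, ∀ y ∈ S, x ≠ y →
    liminf (fun n => edist (iter f 0 n x) (iter f 0 n y)) atTop = 0 ∧
    ENNReal.ofReal δ < limsup (fun n => edist (iter f 0 n x) (iter f 0 n y)) atTop

/-- The system is Li–Yorke `δ`-chaotic. -/
def IsLiYorkeChaotic (f : ℕ → X → X) (δ : ℝ) : Prop :=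
  0 < δ ∧ ∃ S : Set X, ¬ S.Countable ∧ IsLiYorkeScrambled f δ S

/-- `(1/n) ∑_{i<n} χ_{[0,ε)}(d(f_0^i x, f_0^i y))`. -/
def closeFreq (f : ℕ → X → X) (x y : X) (ε : ℝ) (n : ℕ) : ℝ :=
  (1 / (n : ℝ)) * ∑ i ∈ Finset.range n,
    (Ico (0 : ℝ) ε).indicator (fun _ => (1 : ℝ)) (dist (iter f 0 i x) (iter f 0 i y))

/-- `D` is a distributionally scrambled set. -/
def IsDistScrambled (f : ℕ → X → X) (D : Set X) : Prop :=
  ∀ x ∈ D, ∀ y ∈ D, x ≠ y →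
    (∀ ε : ℝ, 0 < ε → limsup (closeFreq f x y ε) atTop = 1) ∧
    ∃ δ : ℝ, 0 < δ ∧ liminf (closeFreq f x y δ) atTop = 0

/-- The system is distributionally chaotic. -/
def IsDistChaotic (f : ℕ → X → X) : Prop :=
  ∃ D : Set X, ¬ D.Countable ∧ IsDistScrambled f D

end Chaos

/-! ### Topological entropy of a non-autonomous system on a subset -/

section Entropy

variable {X : Type*}

/-- The trace `𝒞|_Y = {C ∩ Y : C ∈ 𝒞}` of a family of sets on `Y`. -/
def trace (𝒞 : Set (Set X)) (Y : Set X) : Set (Set X) :=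
  (fun C => C ∩ Y) '' 𝒞

/-- The minimal cardinality of a subfamily of `𝒞` that covers `Y`. -/
def minCard (𝒞 : Set (Set X)) (Y : Set X) : ℕ∞ :=
  ⨅ (𝒟 : Set (Set X)) (_ : 𝒟 ⊆ 𝒞) (_ : Y ⊆ ⋃₀ 𝒟), 𝒟.encard

/-- `𝒜_0^n`, the family of all `⋂_{j<n} f_0^{-j}(A_j)` with `A_j ∈ 𝒜`. -/
def coverJoin (f : ℕ → X → X) (𝒜 : Set (Set X)) (n : ℕ) : Set (Set X) :=
  {W | ∃ a : Fin n → Set X, (∀ j, a j ∈ 𝒜) ∧ W = ⋂ j : Fin n, iter f 0 j ⁻¹' a j}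

/-- `𝒜` is an open cover of `X`. -/
def IsOpenCover [TopologicalSpace X] (𝒜 : Set (Set X)) : Prop :=
  (∀ U ∈ 𝒜, IsOpen U) ∧ ⋃₀ 𝒜 = univ

/-- The topological entropy `h(f_{0,∞}, Y)` on a nonempty subset `Y` of a compact space, the
supremum over all open covers `𝒜` of `limsup (log 𝒩(𝒜_0^n|_Y)) / n`, as an extended real. -/
def topEntropy [TopologicalSpace X] (f : ℕ → X → X) (Y : Set X) : EReal :=
  ⨆ (𝒜 : Set (Set X)) (_ : IsOpenCover 𝒜),
    limsup (fun n : ℕ =>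
      ENNReal.log ((minCard (trace (coverJoin f 𝒜 n) Y) Y : ℕ∞) : ℝ≥0∞) / (n : EReal)) atTop

end Entropy

/-! ### Transition matrices and subshifts of finite type -/

section Subshift

variable {N : ℕ}

/-- A transition matrix: size at least two, entries `0` or `1`, no zero row, no zero column. -/
def IsTransition (A : Matrix (Fin N) (Fin N) ℕ) : Prop :=
  2 ≤ N ∧ (∀ i j, A i j = 0 ∨ A i j = 1) ∧
    (∀ i, 1 ≤ ∑ j, A i j) ∧ (∀ j, 1 ≤ ∑ i, A i j)

/-- Irreducibility: for all `i, j` some positive power of `A` has a positive `(i,j)` entry. -/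
def IsIrred (A : Matrix (Fin N) (Fin N) ℕ) : Prop :=
  ∀ i j, ∃ k : ℕ, 1 ≤ k ∧ 0 < (A ^ k) i j

/-- `‖A^n‖^{1/n}`, where the norm of a matrix is the sum of its entries. -/
def normRoot (A : Matrix (Fin N) (Fin N) ℕ) (n : ℕ) : ℝ :=
  ((∑ i, ∑ j, (A ^ n) i j : ℕ) : ℝ) ^ (1 / (n : ℝ))

/-- `ρ(A) = lim ‖A^n‖^{1/n}`. -/
def rho (A : Matrix (Fin N) (Fin N) ℕ) : ℝ :=
  limUnder atTop (normRoot A)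

/-- The space `Σ_N^+(A)` of one-sided infinite `A`-admissible words. -/
structure SFT (A : Matrix (Fin N) (Fin N) ℕ) where
  /-- the letters of the word -/
  seq : ℕ → Fin N
  /-- consecutive letters are allowed by `A` -/
  adm : ∀ j, A (seq j) (seq (j + 1)) = 1

/-- The shift map `σ_A`. -/
def shift (A : Matrix (Fin N) (Fin N) ℕ) (s : SFT A) : SFT A :=
  ⟨fun j => s.seq (j + 1), fun j => s.adm (j + 1)⟩

variable {A : Matrix (Fin N) (Fin N) ℕ}

/-- The `i`-th term `\hat d(a_i, b_i) / 2^i` of the distance of two words. -/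
def distTerm (s t : SFT A) (i : ℕ) : ℝ :=
  (if s.seq i = t.seq i then 0 else 1) / 2 ^ i

theorem distTerm_nonneg (s t : SFT A) (i : ℕ) : 0 ≤ distTerm s t i := by
  unfold distTerm; split_ifs <;> positivity

theorem summable_distTerm (s t : SFT A) : Summable (distTerm s t) := by
  refine Summable.of_nonneg_of_le (distTerm_nonneg s t) (fun i => ?_) summable_geometric_two
  unfold distTerm
  rw [one_div_pow]
  split_ifs
  · rw [zero_div]; positivity
  · exact le_rfl

/-- The metric `∑ \hat d(a_i, b_i) / 2^i`. -/
instance : MetricSpace (SFT A) where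
  dist s t := ∑' i, distTerm s t i
  dist_self s := by simp [distTerm]
  dist_comm s t := by simp [distTerm, eq_comm]
  dist_triangle s t u := by
    rw [← (summable_distTerm s t).tsum_add (summable_distTerm t u)]
    refine (summable_distTerm s u).tsum_le_tsum (fun i => ?_)
      ((summable_distTerm s t).add (summable_distTerm t u))
    unfold distTerm
    rw [← add_div]
    refine div_le_div_of_nonneg_right ?_ (by positivity)
    split_ifs <;> simp_all
  eq_of_dist_eq_zero := by
    intro s t h
    have h0 := ((summable_distTerm s t).hasSum_iff.2 h)
    rw [hasSum_zero_iff_of_nonneg (distTerm_nonneg s t)] at h0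
    obtain ⟨s, hs⟩ := s
    obtain ⟨t, ht⟩ := t
    have : s = t := by
      funext i
      by_contra hne
      have := congrFun h0 i
      simp [distTerm, hne] at this
    subst this
    rfl

/-- `V_α^{m,n} = ⋂_{k=0}^m f_n^{-k}(V_{a_k, n+k})`. -/
def cyl {X : Type*} (f : ℕ → X → X) (V : Fin N → ℕ → Set X) (α : SFT A) (m n : ℕ) : Set X :=
  ⋂ k ∈ Finset.range (m + 1), iter f n k ⁻¹' V (α.seq k) (n + k)

end Subshift

end NDS

end

/-! The inverse conjugacies are built directly. For a word `α` the sets `cyl f W α m n` decrease in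
`m` and are nonempty and compact, so they share a point `π n α`; it is the only one, as their
diameters tend to `0`. Applying `f n` to it drops the first letter, which gives the semiconjugacy.
Uniformity of the diameters in `n` makes `{π n}` equicontinuous at each word, hence uniformly so on
the compact space of words. Conversely, the distance between the `V i` detects the first letter of
`α` from `π n α`, and equi-continuity of `f` on `E` transports this to later letters
(`exists_coding`). The sets `Λ n` are the ranges of `π n`. Entropy and chaos use only the structure
`IsCoding`.

For the entropy, the admissible words of length `n + 1` number `entrySum A n`, whose exponential
growth rate is `log ρ(A)` by Fekete's lemma. A Lebesgue number bounds every cover by such a count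
(`IsCoding.minCard_le`), and a cover by small balls must separate words
(`IsCoding.exists_le_minCard`).

For chaos, irreducibility and a row with two ones give two periodic words that meet periodically but
take different next letters. A binary sequence decides which to follow on each block (`splice`). The
sequences `spread z` alternate between agreement and disagreement on intervals `[T, T ^ 2)`, so the
upper and lower frequencies of proximity are `1` and `0`. -/

namespace NDS

/-! ### The metric and compactness of the space of words. -/

section SymbolSpace

variable {N : ℕ} {A : Matrix (Fin N) (Fin N) ℕ}

theorem dist_def (s t : SFT A) : dist s t = ∑' i, distTerm s t i := rfl

theorem dist_eq_add (s t : SFT A) :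
    dist s t = (if s.seq 0 = t.seq 0 then 0 else 1) + dist (shift A s) (shift A t) / 2 := by
  rw [dist_def, (summable_distTerm s t).tsum_eq_zero_add, dist_def, ← tsum_div_const]
  congr 1
  · simp [distTerm]
  · refine tsum_congr fun i => ?_
    by_cases h : s.seq (i + 1) = t.seq (i + 1) <;>
      simp [distTerm, shift, h, pow_succ, div_eq_mul_inv, mul_comm]

theorem dist_le_two (s t : SFT A) : dist s t ≤ 2 := by
  rw [dist_def, ← tsum_geometric_two]
  refine (summable_distTerm s t).tsum_le_tsum (fun i => ?_) summable_geometric_two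
  unfold distTerm
  rw [one_div_pow]
  gcongr
  split_ifs <;> norm_num

theorem dist_le_of_agree (m : ℕ) (s t : SFT A) (h : ∀ k < m, s.seq k = t.seq k) :
    dist s t ≤ 2 / 2 ^ m := by
  induction m generalizing s t with
  | zero => simpa using dist_le_two s t
  | succ m ih =>
    have := ih (shift A s) (shift A t) fun k hk => h (k + 1) (by omega)
    rw [dist_eq_add, if_pos (h 0 (by omega)), pow_succ, ← div_div]
    linarith

theorem le_dist_of_ne (k : ℕ) (s t : SFT A) (h : s.seq k ≠ t.seq k) :
    1 / 2 ^ k ≤ dist s t := by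
  have := (summable_distTerm s t).le_tsum k fun i _ => distTerm_nonneg s t i
  rwa [distTerm, if_neg h] at this

theorem exists_agree_dist_lt {ε : ℝ} (hε : 0 < ε) :
    ∃ m : ℕ, ∀ s t : SFT A, (∀ k < m, s.seq k = t.seq k) → dist s t < ε := by
  obtain ⟨m, hm⟩ := exists_pow_lt_of_lt_one (half_pos hε) (by norm_num : (1 / 2 : ℝ) < 1)
  refine ⟨m, fun s t h => (dist_le_of_agree m s t h).trans_lt ?_⟩
  rw [one_div_pow] at hm
  have : (2 : ℝ) / 2 ^ m = 2 * (1 / 2 ^ m) := by ring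
  linarith

theorem agree_of_dist_lt {K k : ℕ} (hk : k ≤ K) {s t : SFT A} (h : dist s t < 1 / 2 ^ K) :
    s.seq k = t.seq k := by
  by_contra hne
  have h1 := le_dist_of_ne k s t hne
  have h2 : (1 : ℝ) / 2 ^ K ≤ 1 / 2 ^ k :=
    one_div_le_one_div_of_le (by positivity) (pow_le_pow_right₀ (by norm_num) hk)
  linarith

/-- The words form a continuous image of a closed subset of the compact product of copies of `Fin
N`. -/
instance instCompactSpaceSFT : CompactSpace (SFT A) := by
  let K : Set (ℕ → Fin N) := {s | ∀ j, A (s j) (s (j + 1)) = 1}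
  have hK : IsClosed K := by
    have : K = ⋂ j, {s : ℕ → Fin N | A (s j) (s (j + 1)) = 1} := by ext; simp [K]
    rw [this]
    refine isClosed_iInter fun j => ?_
    exact (isClosed_discrete {p : Fin N × Fin N | A p.1 p.2 = 1}).preimage
      (by fun_prop : Continuous fun s : ℕ → Fin N => (s j, s (j + 1)))
  have : CompactSpace K := isCompact_iff_compactSpace.1 hK.isCompact
  let g : K → SFT A := fun s => ⟨s.1, s.2⟩
  have hg : Continuous g := by
    refine continuous_iff_continuousAt.2 fun s => Metric.tendsto_nhds.2 fun ε hε => ?_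
    obtain ⟨m, hm⟩ := exists_agree_dist_lt (A := A) hε
    have hev : ∀ᶠ t : K in 𝓝 s, ∀ k ∈ Finset.range m, t.1 k = s.1 k := by
      rw [Filter.eventually_all_finset]
      intro k _
      have hc : Continuous fun t : K => t.1 k :=
        (continuous_apply k).comp continuous_subtype_val
      exact hc.continuousAt.eventually_mem ((isOpen_discrete {s.1 k}).mem_nhds rfl)
    filter_upwards [hev] with t ht
    exact hm _ _ fun k hk => ht k (Finset.mem_range.2 hk)
  have hsurj : Function.Surjective g := fun s => ⟨⟨s.seq, s.adm⟩, rfl⟩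
  exact hsurj.compactSpace hg

/-- Prepend an allowed letter to a word. -/
def SFT.cons (i : Fin N) (s : SFT A) (h : A i (s.seq 0) = 1) : SFT A where
  seq k := Nat.casesOn k i s.seq
  adm j := by cases j with
    | zero => exact h
    | succ j => exact s.adm j

@[simp] theorem SFT.cons_seq_zero (i : Fin N) (s : SFT A) (h : A i (s.seq 0) = 1) :
    (SFT.cons i s h).seq 0 = i := rfl

@[simp] theorem shift_cons (i : Fin N) (s : SFT A) (h : A i (s.seq 0) = 1) :
    shift A (SFT.cons i s h) = s := rfl

theorem IsTransition.exists_succ (hA : IsTransition A) (i : Fin N) : ∃ j, A i j = 1 := by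
  by_contra! h
  have h0 : ∀ j, A i j = 0 := fun j => (hA.2.1 i j).resolve_right (h j)
  have := hA.2.2.1 i
  simp [h0] at this

theorem IsTransition.exists_pred (hA : IsTransition A) (j : Fin N) : ∃ i, A i j = 1 := by
  by_contra! h
  have h0 : ∀ i, A i j = 0 := fun i => (hA.2.1 i j).resolve_right (h i)
  have := hA.2.2.2 j
  simp [h0] at this

theorem IsTransition.exists_word (hA : IsTransition A) (i : Fin N) :
    ∃ s : SFT A, s.seq 0 = i := by
  choose g hg using hA.exists_succ
  exact ⟨⟨fun n => g^[n] i, fun j => by rw [Function.iterate_succ_apply']; exact hg _⟩, rfl⟩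

theorem IsTransition.nonempty (hA : IsTransition A) : Nonempty (SFT A) :=
  (hA.exists_word ⟨0, by have := hA.1; omega⟩).nonempty

theorem IsTransition.shift_surjective (hA : IsTransition A) :
    Function.Surjective (shift A) := fun s => by
  obtain ⟨i, hi⟩ := hA.exists_pred (s.seq 0)
  exact ⟨SFT.cons i s hi, rfl⟩

theorem shift_iterate_seq (i k : ℕ) (s : SFT A) : ((shift A)^[i] s).seq k = s.seq (i + k) := by
  induction i generalizing s with
  | zero => simp
  | succ i ih => rw [Function.iterate_succ_apply, ih]; simp only [shift]; congr 1; omega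

end SymbolSpace

/-! ### Coding orbits by words. -/

section Coding

variable {X : Type*}

theorem iter_succ_apply (f : ℕ → X → X) (n k : ℕ) (x : X) :
    iter f n (k + 1) x = iter f (n + 1) k (f n x) := by
  induction k with
  | zero => rfl
  | succ k ih =>
    change f (n + (k + 1)) (iter f n (k + 1) x) = f (n + 1 + k) (iter f (n + 1) k (f n x))
    rw [ih]; congr 1; omega

variable {N : ℕ} {A : Matrix (Fin N) (Fin N) ℕ}

theorem mem_cyl {f : ℕ → X → X} {W : Fin N → ℕ → Set X} {α : SFT A} {m n : ℕ} {x : X} :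
    x ∈ cyl f W α m n ↔ ∀ k ≤ m, iter f n k x ∈ W (α.seq k) (n + k) := by
  simp [cyl]

theorem cyl_zero (f : ℕ → X → X) (W : Fin N → ℕ → Set X) (α : SFT A) (n : ℕ) :
    cyl f W α 0 n = W (α.seq 0) n := by
  ext x; rw [mem_cyl]; simp [iter]

theorem cyl_succ (f : ℕ → X → X) (W : Fin N → ℕ → Set X) (α : SFT A) (m n : ℕ) :
    cyl f W α (m + 1) n = W (α.seq 0) n ∩ f n ⁻¹' cyl f W (shift A α) m (n + 1) := by
  ext x
  rw [mem_inter_iff, mem_preimage, mem_cyl, mem_cyl]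
  constructor
  · intro h
    refine ⟨by simpa [iter] using h 0 (by omega), fun k hk => ?_⟩
    have := h (k + 1) (by omega)
    rw [iter_succ_apply] at this
    simpa only [shift, Nat.add_assoc, Nat.add_comm 1 k] using this
  · rintro ⟨h0, h⟩ k hk
    cases k with
    | zero => simpa [iter] using h0
    | succ k =>
      rw [iter_succ_apply]
      simpa only [shift, Nat.add_assoc, Nat.add_comm 1 k] using h k (by omega)

theorem cyl_antitone (f : ℕ → X → X) (W : Fin N → ℕ → Set X) (α : SFT A) (n : ℕ) :
    Antitone fun m => cyl f W α m n := fun _ _ hab _ hx =>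
  mem_cyl.2 fun k hk => mem_cyl.1 hx k (hk.trans hab)

variable [MetricSpace X]

/-- Since `f n` is continuous only on the compact sets `W i n`, closedness is obtained one map at a
time through `cyl_succ`, as that of a preimage within such a set. -/
theorem isCompact_cyl {f : ℕ → X → X} {W : Fin N → ℕ → Set X}
    (hWc : ∀ i n, IsCompact (W i n)) (hf : ∀ i n, ContinuousOn (f n) (W i n))
    (α : SFT A) (m n : ℕ) : IsCompact (cyl f W α m n) := by
  induction m generalizing α n with
  | zero => rw [cyl_zero]; exact hWc _ _
  | succ m ih =>
    rw [cyl_succ]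
    exact (hWc _ n).of_isClosed_subset
      ((hf _ n).preimage_isClosed_of_isClosed (hWc _ n).isClosed (ih _ _).isClosed)
      inter_subset_left

/-- A semiconjugacy `π n : Σ_N^+(A) → X` from the shift to `f`, such that the maps `π n` and their
inverses are equi-continuous. -/
structure IsCoding (f : ℕ → X → X) (A : Matrix (Fin N) (Fin N) ℕ) (π : ℕ → SFT A → X) :
    Prop where
  semiconj : ∀ n α, f n (π n α) = π (n + 1) (shift A α)
  equicontinuous : ∀ ε : ℝ, 0 < ε → ∃ δ : ℝ, 0 < δ ∧
    ∀ n α β, dist α β < δ → dist (π n α) (π n β) < ε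
  equicontinuous_inv : ∀ ε : ℝ, 0 < ε → ∃ δ : ℝ, 0 < δ ∧
    ∀ n α β, dist (π n α) (π n β) < δ → dist α β < ε

/-- There are finitely many pairs of indices, so every small enough positive `δ` works for all of
them. -/
theorem exists_le_dist_of_setDist_pos {V : Fin N → Set X}
    (hVd : ∀ i j, i ≠ j → 0 < setDist (V i) (V j)) :
    ∃ δ : ℝ, 0 < δ ∧ ∀ i j, i ≠ j → ∀ x ∈ V i, ∀ y ∈ V j, δ ≤ dist x y := by
  have h : ∀ᶠ δ in 𝓝[>] (0 : ℝ), ∀ p : Fin N × Fin N, p.1 ≠ p.2 →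
      δ ≤ setDist (V p.1) (V p.2) := by
    rw [Filter.eventually_all]
    rintro ⟨i, j⟩
    rw [Filter.eventually_imp_distrib_left]
    intro hij
    exact (eventually_nhdsWithin_of_eventually_nhds (eventually_lt_nhds (hVd i j hij))).mono
      fun _ => le_of_lt
  obtain ⟨δ, hδ, hpos⟩ := (h.and self_mem_nhdsWithin).exists
  refine ⟨δ, hpos, fun i j hij x hx y hy => (hδ (i, j) hij).trans (csInf_le ⟨0, ?_⟩ ?_)⟩
  · rintro _ ⟨a, _, b, _, rfl⟩; exact dist_nonneg
  · exact ⟨x, hx, y, hy, rfl⟩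

theorem exists_coding (f : ℕ → X → X) (V : Fin N → Set X)
    (hVd : ∀ i j, i ≠ j → 0 < setDist (V i) (V j))
    (W : Fin N → ℕ → Set X) (hWc : ∀ i n, IsCompact (W i n)) (hWV : ∀ i n, W i n ⊆ V i)
    (hf : EquiContinuous (fun n => (⋃ (k : ℕ) (i : Fin N), W i k).domRestrict (f n)))
    (H1 : ∀ (m n : ℕ) (α : SFT A), (cyl f W α m n).Nonempty)
    (H2 : ∀ α : SFT A, ∀ ε : ℝ, 0 < ε → ∃ M : ℕ, ∀ m ≥ M, ∀ n : ℕ,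
      Metric.diam (cyl f W α m n) < ε) :
    ∃ π : ℕ → SFT A → X, (∀ n α, π n α ∈ W (α.seq 0) n) ∧ IsCoding f A π := by
  have hf' : ∀ ε : ℝ, 0 < ε → ∃ δ : ℝ, 0 < δ ∧ ∀ (n i j k l : _) (x y : X), x ∈ W i k →
      y ∈ W j l → dist x y < δ → dist (f n x) (f n y) < ε := by
    intro ε hε
    obtain ⟨δ, hδ, h⟩ := hf ε hε
    exact ⟨δ, hδ, fun n i j k l x y hx hy hxy => h n ⟨x, mem_iUnion₂.2 ⟨k, i, hx⟩⟩
      ⟨y, mem_iUnion₂.2 ⟨l, j, hy⟩⟩ hxy⟩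
  have hcont : ∀ i n, ContinuousOn (f n) (W i n) := fun i n => by
    refine Metric.continuousOn_iff.2 fun x hx ε hε => ?_
    obtain ⟨δ, hδ, h⟩ := hf' ε hε
    exact ⟨δ, hδ, fun y hy hyx => h n _ _ _ _ y x hy hx hyx⟩
  have hcomp : ∀ (α : SFT A) m n, IsCompact (cyl f W α m n) :=
    isCompact_cyl hWc hcont
  have hpt : ∀ n (α : SFT A), (⋂ m, cyl f W α m n).Nonempty := fun n α =>
    IsCompact.nonempty_iInter_of_sequence_nonempty_isCompact_isClosed _
      (fun m => cyl_antitone f W α n (Nat.le_succ m)) (fun m => H1 m n α) (hcomp α 0 n)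
      (fun m => (hcomp α m n).isClosed)
  choose π hπ using hpt
  replace hπ : ∀ n α m, π n α ∈ cyl f W α m n := fun n α m => mem_iInter.1 (hπ n α) m
  have hπW : ∀ n α, π n α ∈ W (α.seq 0) n := fun n α => by
    have := hπ n α 0
    rwa [cyl_zero] at this
  have hsemi : ∀ n α, f n (π n α) = π (n + 1) (shift A α) := by
    intro n α
    -- Both points lie in every cylinder of `shift A α`, and these have arbitrarily small diameter.
    refine eq_of_forall_dist_le fun ε hε => ?_
    obtain ⟨M, hM⟩ := H2 (shift A α) ε hε
    refine (Metric.dist_le_diam_of_mem (hcomp _ M (n + 1)).isBounded ?_ (hπ _ _ M)).trans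
      (hM M le_rfl (n + 1)).le
    have := hπ n α (M + 1)
    rw [cyl_succ] at this
    exact this.2
  refine ⟨π, hπW, hsemi, ?_, ?_⟩
  -- The `M` in `H2` may depend on `α`, so only equicontinuity at each point is direct; compactness
  -- of `SFT A` makes it uniform.
  · have : Equicontinuous π := by
      intro α
      refine Metric.equicontinuousAt_iff.2 fun ε hε => ?_
      obtain ⟨M, hM⟩ := H2 α ε hε
      refine ⟨1 / 2 ^ M, by positivity, fun β hβ n => ?_⟩
      refine (Metric.dist_le_diam_of_mem (hcomp α M n).isBounded (hπ _ _ M) ?_).trans_lt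
        (hM M le_rfl n)
      refine mem_cyl.2 fun k hk => ?_
      rw [← agree_of_dist_lt hk hβ]
      exact mem_cyl.1 (hπ n β M) k hk
    intro ε hε
    obtain ⟨δ, hδ, h⟩ := Metric.uniformEquicontinuous_iff.1
      (CompactSpace.uniformEquicontinuous_of_equicontinuous this) ε hε
    exact ⟨δ, hδ, fun n α β hab => h α β hab n⟩
  · obtain ⟨d₀, hd₀, hd⟩ := exists_le_dist_of_setDist_pos hVd
    -- Close points code words with many common letters: the first letter by separation of the `V
    -- i`, the others by applying `f n` and using the previous `δ` at time `n + 1`.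
    have key : ∀ K : ℕ, ∃ δ : ℝ, 0 < δ ∧ ∀ n (α β : SFT A), dist (π n α) (π n β) < δ →
        ∀ k < K, α.seq k = β.seq k := by
      intro K
      induction K with
      | zero => exact ⟨1, one_pos, fun _ _ _ _ k hk => by omega⟩
      | succ K ih =>
        obtain ⟨δ₁, hδ₁, h₁⟩ := ih
        obtain ⟨δ₂, hδ₂, h₂⟩ := hf' δ₁ hδ₁
        refine ⟨min d₀ δ₂, lt_min hd₀ hδ₂, fun n α β hab k hk => ?_⟩
        cases k with
        | zero =>
          by_contra hne
          exact absurd (hd _ _ hne _ (hWV _ _ (hπW n α)) _ (hWV _ _ (hπW n β)))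
            (not_le.2 (hab.trans_le (min_le_left _ _)))
        | succ k =>
          have := h₂ n _ _ _ _ _ _ (hπW n α) (hπW n β) (hab.trans_le (min_le_right _ _))
          rw [hsemi, hsemi] at this
          exact h₁ _ _ _ this k (by omega)
    intro ε hε
    obtain ⟨m, hm⟩ := exists_agree_dist_lt (A := A) hε
    obtain ⟨δ, hδ, h⟩ := key m
    exact ⟨δ, hδ, fun n α β hab => hm _ _ (h n α β hab)⟩

namespace IsCoding

variable {f : ℕ → X → X} {π : ℕ → SFT A → X}

theorem injective (hπ : IsCoding f A π) (n : ℕ) : Function.Injective (π n) := by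
  intro α β h
  refine eq_of_forall_dist_le fun ε hε => ?_
  obtain ⟨δ, hδ, hd⟩ := hπ.equicontinuous_inv ε hε
  exact (hd n α β (by rwa [h, dist_self])).le

theorem continuous (hπ : IsCoding f A π) (n : ℕ) : Continuous (π n) := by
  refine Metric.continuous_iff.2 fun α ε hε => ?_
  obtain ⟨δ, hδ, hd⟩ := hπ.equicontinuous ε hε
  exact ⟨δ, hδ, fun β hβ => hd n β α hβ⟩

theorem iter_eq (hπ : IsCoding f A π) (i : ℕ) (α : SFT A) :
    iter f 0 i (π 0 α) = π i ((shift A)^[i] α) := by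
  induction i with
  | zero => rfl
  | succ i ih =>
    change f (0 + i) (iter f 0 i (π 0 α)) = _
    rw [Nat.zero_add, ih, hπ.semiconj, Function.iterate_succ_apply']

theorem image_range (hπ : IsCoding f A π) (hA : IsTransition A) (n : ℕ) :
    f n '' range (π n) = range (π (n + 1)) := by
  rw [← range_comp]
  have : f n ∘ π n = π (n + 1) ∘ shift A := funext (hπ.semiconj n)
  rw [this, hA.shift_surjective.range_comp]

theorem exists_agree (hπ : IsCoding f A π) {ε : ℝ} (hε : 0 < ε) :
    ∃ m : ℕ, ∀ n α β, (∀ k < m, α.seq k = β.seq k) → dist (π n α) (π n β) < ε := by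
  obtain ⟨δ, hδ, h⟩ := hπ.equicontinuous ε hε
  obtain ⟨m, hm⟩ := exists_agree_dist_lt (A := A) hδ
  exact ⟨m, fun n α β hab => h n α β (hm α β hab)⟩

theorem exists_le_dist (hπ : IsCoding f A π) (K : ℕ) :
    ∃ δ : ℝ, 0 < δ ∧ ∀ n α β, ∀ k ≤ K, α.seq k ≠ β.seq k → δ ≤ dist (π n α) (π n β) := by
  obtain ⟨δ, hδ, h⟩ := hπ.equicontinuous_inv (1 / 2 ^ K) (by positivity)
  refine ⟨δ, hδ, fun n α β k hk hne => not_lt.1 fun hlt => hne ?_⟩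
  exact agree_of_dist_lt hk (h n α β hlt)

theorem equiConjugate (hπ : IsCoding f A π) :
    EquiConjugate f (fun n => range (π n)) (fun _ => shift A) (fun _ => univ) := by
  have hΛ : IsInvariantSeq f fun n => range (π n) := by
    rintro n _ ⟨α, rfl⟩
    exact ⟨shift A α, (hπ.semiconj n α).symm⟩
  let e : ∀ n, (univ : Set (SFT A)) ≃ range (π n) := fun n =>
    (Equiv.Set.univ _).trans (Equiv.ofInjective (π n) (hπ.injective n))
  have he : ∀ n x, ((e n x : range (π n)) : X) = π n x := fun _ _ => rfl
  have hes : ∀ n (x : range (π n)), π n ((e n).symm x) = x := fun n x => by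
    rw [← he, Equiv.apply_symm_apply]
  refine ⟨hΛ, fun n => mapsTo_univ _ _, fun n => (e n).symm, ?_, ?_, ?_⟩
  · intro ε hε
    obtain ⟨δ, hδ, h⟩ := hπ.equicontinuous_inv ε hε
    refine ⟨δ, hδ, fun n x y hxy => h n _ _ ?_⟩
    rwa [hes, hes]
  · intro ε hε
    obtain ⟨δ, hδ, h⟩ := hπ.equicontinuous ε hε
    exact ⟨δ, hδ, fun n x y hxy => h n x y hxy⟩
  · intro n x
    apply (e (n + 1)).injective
    rw [Equiv.apply_symm_apply]
    apply Subtype.ext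
    rw [he]
    change f n x = π (n + 1) (shift A ((e n).symm x))
    rw [← hπ.semiconj, hes]

end IsCoding

end Coding

end NDS

namespace NDS

/-! ### Counting admissible words, and the growth rate of the matrix powers. -/

section Words

variable {N : ℕ}

/-- The sum of the entries of `A ^ n`. -/
def entrySum (A : Matrix (Fin N) (Fin N) ℕ) (n : ℕ) : ℕ := ∑ i, ∑ j, (A ^ n) i j

/-- The admissible words of length `n + 1` with first letter `i`. -/
def words (A : Matrix (Fin N) (Fin N) ℕ) : ℕ → Fin N → Finset (List (Fin N))
  | 0, i => {[i]}
  | n + 1, i => (Finset.univ.filter fun j => A i j = 1).biUnion fun j =>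
      (words A n j).image (List.cons i)

variable {A : Matrix (Fin N) (Fin N) ℕ}

theorem head?_of_mem_words {n : ℕ} {i : Fin N} {w : List (Fin N)} (h : w ∈ words A n i) :
    w.head? = some i := by
  cases n with
  | zero => rw [words, Finset.mem_singleton] at h; simp [h]
  | succ n =>
    simp only [words, Finset.mem_biUnion, Finset.mem_image] at h
    obtain ⟨j, _, v, _, rfl⟩ := h
    rfl

theorem words_disjoint (n : ℕ) {i j : Fin N} (hij : i ≠ j) :
    Disjoint (words A n i) (words A n j) := by
  refine Finset.disjoint_left.2 fun w hi hj => hij ?_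
  have := head?_of_mem_words hi
  rw [head?_of_mem_words hj] at this
  exact (Option.some.inj this).symm

theorem card_words (hA : IsTransition A) (n : ℕ) (i : Fin N) :
    (words A n i).card = ∑ j, (A ^ n) i j := by
  induction n generalizing i with
  | zero => simp [words, Matrix.one_apply]
  | succ n ih =>
    have hinj : Function.Injective (List.cons i) := List.cons_injective
    rw [words, Finset.card_biUnion]
    · simp only [Finset.card_image_of_injective _ hinj, ih, pow_succ', Matrix.mul_apply]
      rw [Finset.sum_comm (s := (Finset.univ : Finset (Fin N))), Finset.sum_filter]
      refine Finset.sum_congr rfl fun j _ => ?_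
      rw [← Finset.mul_sum]
      rcases hA.2.1 i j with h | h <;> simp [h]
    · intro j _ k _ hjk
      exact (Finset.disjoint_image hinj).2 (words_disjoint n hjk)

/-- The admissible words of length `n + 1`. -/
def allWords (A : Matrix (Fin N) (Fin N) ℕ) (n : ℕ) : Finset (List (Fin N)) :=
  Finset.univ.biUnion (words A n)

theorem card_allWords (hA : IsTransition A) (n : ℕ) : (allWords A n).card = entrySum A n := by
  rw [allWords, Finset.card_biUnion fun i _ j _ hij => words_disjoint n hij, entrySum]
  exact Finset.sum_congr rfl fun i _ => card_words hA n i

/-- The first `n + 1` letters of a word. -/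
def SFT.prefix : ℕ → SFT A → List (Fin N)
  | 0, s => [s.seq 0]
  | n + 1, s => s.seq 0 :: SFT.prefix n (shift A s)

theorem prefix_mem_words (n : ℕ) (s : SFT A) : SFT.prefix n s ∈ words A n (s.seq 0) := by
  induction n generalizing s with
  | zero => simp [SFT.prefix, words]
  | succ n ih =>
    simp only [SFT.prefix, words, Finset.mem_biUnion, Finset.mem_image, Finset.mem_filter]
    exact ⟨s.seq 1, ⟨Finset.mem_univ _, s.adm 0⟩, _, ih (shift A s), rfl⟩

theorem prefix_mem_allWords (n : ℕ) (s : SFT A) : SFT.prefix n s ∈ allWords A n :=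
  Finset.mem_biUnion.2 ⟨_, Finset.mem_univ _, prefix_mem_words n s⟩

theorem exists_prefix_eq_of_mem_words (hA : IsTransition A) {n : ℕ} {i : Fin N}
    {w : List (Fin N)} (h : w ∈ words A n i) :
    ∃ s : SFT A, s.seq 0 = i ∧ SFT.prefix n s = w := by
  induction n generalizing i w with
  | zero =>
    obtain ⟨s, hs⟩ := hA.exists_word i
    rw [words, Finset.mem_singleton] at h
    exact ⟨s, hs, by rw [h, SFT.prefix, hs]⟩
  | succ n ih =>
    simp only [words, Finset.mem_biUnion, Finset.mem_image, Finset.mem_filter] at h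
    obtain ⟨j, ⟨_, hj⟩, v, hv, rfl⟩ := h
    obtain ⟨s, hs, hsv⟩ := ih hv
    refine ⟨SFT.cons i s (hs ▸ hj), rfl, ?_⟩
    rw [SFT.prefix, shift_cons, hsv, SFT.cons_seq_zero]

theorem exists_prefix_eq (hA : IsTransition A) {n : ℕ} {w : List (Fin N)}
    (h : w ∈ allWords A n) : ∃ s : SFT A, SFT.prefix n s = w := by
  obtain ⟨i, _, hi⟩ := Finset.mem_biUnion.1 h
  obtain ⟨s, _, hs⟩ := exists_prefix_eq_of_mem_words hA hi
  exact ⟨s, hs⟩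

theorem prefix_eq_iff (n : ℕ) (s t : SFT A) :
    SFT.prefix n s = SFT.prefix n t ↔ ∀ k ≤ n, s.seq k = t.seq k := by
  induction n generalizing s t with
  | zero => simp [SFT.prefix]
  | succ n ih =>
    simp only [SFT.prefix, List.cons.injEq, ih]
    constructor
    · rintro ⟨h0, h⟩ k hk
      cases k with
      | zero => exact h0
      | succ k => exact h k (by omega)
    · exact fun h => ⟨h 0 (by omega), fun k hk => h (k + 1) (by omega)⟩

theorem entrySum_pos (hA : IsTransition A) (n : ℕ) : 0 < entrySum A n := by
  rw [← card_allWords hA]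
  obtain ⟨s⟩ := hA.nonempty
  exact Finset.card_pos.2 ⟨_, prefix_mem_allWords n s⟩

/-- Each row sum of `A ^ n` is at most the sum of all entries. This submultiplicativity feeds
Fekete's lemma. -/
theorem entrySum_add_le (A : Matrix (Fin N) (Fin N) ℕ) (m n : ℕ) :
    entrySum A (m + n) ≤ entrySum A m * entrySum A n := by
  simp only [entrySum, pow_add, Matrix.mul_apply, Finset.sum_mul]
  refine Finset.sum_le_sum fun i _ => ?_
  rw [Finset.sum_comm]
  refine Finset.sum_le_sum fun k _ => ?_
  rw [← Finset.mul_sum]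
  exact Nat.mul_le_mul_left _
    (Finset.single_le_sum (f := fun k => ∑ j, (A ^ n) k j) (fun _ _ => Nat.zero_le _)
      (Finset.mem_univ k))

theorem exists_tendsto_log_entrySum (hA : IsTransition A) :
    ∃ l : ℝ, Tendsto (fun n : ℕ => Real.log (entrySum A n) / n) atTop (𝓝 l) := by
  have hpos : ∀ n, (1 : ℝ) ≤ entrySum A n := fun n => by exact_mod_cast entrySum_pos hA n
  have hsub : Subadditive fun n => Real.log (entrySum A n) := fun m n => by
    rw [← Real.log_mul (by linarith [hpos m]) (by linarith [hpos n])]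
    refine Real.log_le_log (by linarith [hpos (m + n)]) ?_
    exact_mod_cast entrySum_add_le A m n
  refine ⟨hsub.lim, hsub.tendsto_lim ⟨0, ?_⟩⟩
  rintro _ ⟨n, rfl⟩
  exact div_nonneg (Real.log_nonneg (hpos n)) n.cast_nonneg

theorem tendsto_normRoot (hA : IsTransition A) :
    Tendsto (normRoot A) atTop (𝓝 (rho A)) ∧ 0 < rho A ∧
      Tendsto (fun n : ℕ => Real.log (entrySum A n) / n) atTop (𝓝 (Real.log (rho A))) := by
  obtain ⟨l, hl⟩ := exists_tendsto_log_entrySum hA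
  have h : Tendsto (normRoot A) atTop (𝓝 (Real.exp l)) := by
    refine ((Real.continuous_exp.tendsto l).comp hl).congr fun n => ?_
    have : (0 : ℝ) < entrySum A n := by exact_mod_cast entrySum_pos hA n
    change _ = (entrySum A n : ℝ) ^ (1 / (n : ℝ))
    rw [Real.rpow_def_of_pos this, mul_one_div]
    rfl
  have hrho : rho A = Real.exp l := h.limUnder_eq
  rw [hrho, Real.log_exp]
  exact ⟨h, Real.exp_pos l, hl⟩

theorem tendsto_log_entrySum_add (hA : IsTransition A) (m : ℕ) :
    Tendsto (fun n : ℕ => Real.log (entrySum A (n + m)) / n) atTop (𝓝 (Real.log (rho A))) := by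
  have h1 := (tendsto_add_atTop_iff_nat m).2 (tendsto_normRoot hA).2.2
  have h2 : Tendsto (fun n : ℕ => ((n + m : ℕ) : ℝ) / n) atTop (𝓝 1) := by
    have : Tendsto (fun n : ℕ => 1 + (m : ℝ) / n) atTop (𝓝 (1 + 0)) :=
      tendsto_const_nhds.add (tendsto_const_div_atTop_nhds_zero_nat _)
    rw [add_zero] at this
    refine this.congr' ?_
    filter_upwards [eventually_gt_atTop 0] with n hn
    have : (n : ℝ) ≠ 0 := by positivity
    push_cast
    field_simp
  have := h1.mul h2
  rw [mul_one] at this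
  refine this.congr' ?_
  filter_upwards [eventually_gt_atTop 0] with n hn
  have : ((n + m : ℕ) : ℝ) ≠ 0 := by positivity
  field_simp

end Words

/-! ### Topological entropy of the coded set. -/

section Entropy

variable {X : Type*} [MetricSpace X] {N : ℕ} {A : Matrix (Fin N) (Fin N) ℕ}
  {f : ℕ → X → X} {π : ℕ → SFT A → X}

theorem log_natCast_div {c : ℕ} (hc : 0 < c) (n : ℕ) :
    ENNReal.log (((c : ℕ∞)) : ℝ≥0∞) / (n : EReal) = ((Real.log c / n : ℝ) : EReal) := by
  have : (((c : ℕ∞)) : ℝ≥0∞) = (c : ℝ≥0∞) := by simp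
  rw [this, ENNReal.log_pos_real (by simpa using hc.ne') (by simp)]
  simp [EReal.coe_div]

theorem log_div_mono {a b : ℕ∞} (h : a ≤ b) (n : ℕ) :
    ENNReal.log (a : ℝ≥0∞) / (n : EReal) ≤ ENNReal.log (b : ℝ≥0∞) / (n : EReal) := by
  refine EReal.div_le_div_right_of_nonneg (by positivity) (ENNReal.log_monotone ?_)
  exact_mod_cast h

/-- If words agree in `m` letters from time `j` on, their points at time `j` are closer than a
Lebesgue number of the cover. So one member of the join serves all points whose words share a prefix
of length `n + m + 1`. -/
theorem IsCoding.minCard_le (hπ : IsCoding f A π) (hA : IsTransition A) [CompactSpace X]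
    {𝒜 : Set (Set X)} (h𝒜 : IsOpenCover 𝒜) :
    ∃ m : ℕ, ∀ n, minCard (trace (coverJoin f 𝒜 n) (range (π 0))) (range (π 0)) ≤
      (entrySum A (n + m) : ℕ∞) := by
  obtain ⟨r, hr, hball⟩ := lebesgue_number_lemma_of_metric_sUnion isCompact_univ h𝒜.1 h𝒜.2.ge
  obtain ⟨m, hm⟩ := hπ.exists_agree hr
  refine ⟨m, fun n => ?_⟩
  choose! U hU hUball using fun x => hball x (mem_univ x)
  have hword : ∀ w : allWords A (n + m), ∃ s : SFT A, SFT.prefix (n + m) s = w.1 :=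
    fun w => exists_prefix_eq hA w.2
  choose s hs using hword
  -- `s w` represents the prefix `w`, and `U` picks a member of the cover containing the `r`-ball
  -- around each point of its orbit.
  let B : allWords A (n + m) → Set X := fun w =>
    (⋂ j : Fin n, iter f 0 j ⁻¹' U (iter f 0 j (π 0 (s w)))) ∩ range (π 0)
  have hB : range B ⊆ trace (coverJoin f 𝒜 n) (range (π 0)) := by
    rintro _ ⟨w, rfl⟩
    exact ⟨_, ⟨fun j => U (iter f 0 j (π 0 (s w))), fun j => hU _, rfl⟩, rfl⟩
  have hcov : range (π 0) ⊆ ⋃₀ range B := by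
    rintro _ ⟨α, rfl⟩
    refine ⟨_, ⟨⟨_, prefix_mem_allWords (n + m) α⟩, rfl⟩, mem_iInter.2 fun j => ?_, α, rfl⟩
    refine hUball _ ?_
    rw [Metric.mem_ball, hπ.iter_eq, hπ.iter_eq]
    refine hm _ _ _ fun k hk => ?_
    rw [shift_iterate_seq, shift_iterate_seq]
    exact (prefix_eq_iff (n + m) _ _).1 (hs ⟨_, prefix_mem_allWords (n + m) α⟩).symm _ (by omega)
  refine (iInf₂_le_of_le (range B) hB (iInf_le _ hcov)).trans ?_
  rw [← image_univ, ← card_allWords hA]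
  refine (encard_image_le _ _).trans ?_
  simp

/-- Points whose words differ in the first letter are at least `δ` apart, hence never in one ball of
radius `δ / 2`. A member of the join over times `0, …, n` thus determines the first `n + 1` letters.
-/
theorem IsCoding.exists_le_minCard (hπ : IsCoding f A π) (hA : IsTransition A) :
    ∃ 𝒜 : Set (Set X), IsOpenCover 𝒜 ∧ ∀ n,
      (entrySum A n : ℕ∞) ≤
        minCard (trace (coverJoin f 𝒜 (n + 1)) (range (π 0))) (range (π 0)) := by
  obtain ⟨δ, hδ, hd⟩ := hπ.exists_le_dist 0
  refine ⟨range fun x => Metric.ball x (δ / 2), ⟨?_, ?_⟩, fun n => ?_⟩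
  · rintro _ ⟨x, rfl⟩; exact Metric.isOpen_ball
  · exact eq_univ_of_forall fun x => ⟨_, ⟨x, rfl⟩, Metric.mem_ball_self (half_pos hδ)⟩
  refine le_iInf₂ fun 𝒟 h𝒟 => le_iInf fun hcov => ?_
  have hword : ∀ w ∈ allWords A n, ∃ s : SFT A, SFT.prefix n s = w :=
    fun w hw => exists_prefix_eq hA hw
  obtain ⟨s₀⟩ := hA.nonempty
  have : Nonempty (SFT A) := ⟨s₀⟩
  choose! s hs using hword
  choose D hD hmem using fun w => hcov (mem_range_self (s w))
  rw [← card_allWords hA, ← encard_coe_eq_coe_finsetCard]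
  refine encard_le_encard_of_injOn (f := D) (fun w _ => hD w) fun w hw v hv hwv => ?_
  rw [← hs w hw, ← hs v hv, prefix_eq_iff]
  intro k hk
  obtain ⟨_, ⟨a, ha, rfl⟩, hC⟩ := h𝒟 (hD w)
  have hw' := hmem w
  have hv' := hmem v
  rw [← hwv] at hv'
  rw [← hC] at hw' hv'
  obtain ⟨x, hx⟩ := ha ⟨k, by omega⟩
  have h1 := mem_iInter.1 hw'.1 ⟨k, by omega⟩
  have h2 := mem_iInter.1 hv'.1 ⟨k, by omega⟩
  rw [← hx, mem_preimage, hπ.iter_eq, Metric.mem_ball] at h1 h2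
  by_contra hne
  have h3 := hd k ((shift A)^[k] (s w)) ((shift A)^[k] (s v)) 0 le_rfl (by
    rwa [shift_iterate_seq, shift_iterate_seq])
  have h4 := dist_triangle_right (π k ((shift A)^[k] (s w))) (π k ((shift A)^[k] (s v))) x
  simp only at h1 h2
  linarith

theorem IsCoding.topEntropy_eq (hπ : IsCoding f A π) (hA : IsTransition A) [CompactSpace X] :
    topEntropy f (range (π 0)) = ((Real.log (rho A) : ℝ) : EReal) := by
  refine le_antisymm (iSup₂_le fun 𝒜 h𝒜 => ?_) ?_
  · obtain ⟨m, hm⟩ := hπ.minCard_le hA h𝒜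
    have h := (continuous_coe_real_ereal.tendsto _).comp (tendsto_log_entrySum_add hA m)
    refine le_trans (limsup_le_limsup (Eventually.of_forall fun n => ?_)) h.limsup_eq.le
    exact (log_div_mono (hm n) n).trans (log_natCast_div (entrySum_pos hA _) n).le
  · obtain ⟨𝒜, h𝒜, hm⟩ := hπ.exists_le_minCard hA
    -- The join over `n` times sees words of length `n`, counted by `entrySum A (n - 1)`.
    have h0 : Tendsto (fun n : ℕ => Real.log (entrySum A (n - 1)) / n) atTop
        (𝓝 (Real.log (rho A))) := by
      rw [← tendsto_add_atTop_iff_nat 1]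
      have h1 := (tendsto_normRoot hA).2.2.mul (tendsto_natCast_div_add_atTop (1 : ℝ))
      rw [mul_one] at h1
      refine h1.congr' ?_
      filter_upwards [eventually_gt_atTop 0] with n hn
      have : (n : ℝ) ≠ 0 := by positivity
      have : (n : ℝ) + 1 ≠ 0 := by positivity
      rw [Nat.add_sub_cancel]
      push_cast
      field_simp
    have h := (continuous_coe_real_ereal.tendsto _).comp h0
    refine le_iSup₂_of_le 𝒜 h𝒜 (h.limsup_eq.ge.trans (limsup_le_limsup ?_))
    filter_upwards [eventually_gt_atTop 0] with n hn
    obtain ⟨n, rfl⟩ : ∃ k, n = k + 1 := ⟨n - 1, by omega⟩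
    exact (log_natCast_div (entrySum_pos hA _) _).ge.trans (log_div_mono (hm n) _)

end Entropy

end NDS

namespace NDS

/-! ### From long stretches of proximity and separation to chaos. -/

section Frequencies

variable {X : Type*} [MetricSpace X] {f : ℕ → X → X} {x y : X}

theorem closeFreq_eq_card_div (ε : ℝ) (n : ℕ) :
    closeFreq f x y ε n =
      ((Finset.range n).filter fun i => dist (iter f 0 i x) (iter f 0 i y) < ε).card / (n : ℝ) := by
  rw [closeFreq, one_div_mul_eq_div, Finset.card_filter, Nat.cast_sum]
  congr 1
  refine Finset.sum_congr rfl fun i _ => ?_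
  simp [indicator_apply, dist_nonneg]

theorem closeFreq_nonneg (ε : ℝ) (n : ℕ) : 0 ≤ closeFreq f x y ε n := by
  rw [closeFreq_eq_card_div]; positivity

theorem closeFreq_le_one (ε : ℝ) (n : ℕ) : closeFreq f x y ε n ≤ 1 := by
  rw [closeFreq_eq_card_div]
  refine div_le_one_of_le₀ ?_ n.cast_nonneg
  exact_mod_cast (Finset.card_filter_le _ _).trans (Finset.card_range n).le

theorem le_closeFreq {ε : ℝ} {a b : ℕ} (hb : 0 < b)
    (h : ∀ i, a ≤ i → i < b → dist (iter f 0 i x) (iter f 0 i y) < ε) :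
    1 - (a : ℝ) / b ≤ closeFreq f x y ε b := by
  have hb' : (0 : ℝ) < b := by exact_mod_cast hb
  rw [closeFreq_eq_card_div, one_sub_div hb'.ne']
  refine div_le_div_of_nonneg_right ?_ hb'.le
  have : Finset.Ico a b ⊆
      (Finset.range b).filter fun i => dist (iter f 0 i x) (iter f 0 i y) < ε := by
    intro i hi
    rw [Finset.mem_Ico] at hi
    exact Finset.mem_filter.2 ⟨Finset.mem_range.2 hi.2, h i hi.1 hi.2⟩
  have := Finset.card_le_card this
  rw [Nat.card_Ico] at this
  rw [sub_le_iff_le_add]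
  exact_mod_cast Nat.sub_le_iff_le_add.1 this

theorem closeFreq_le {ε : ℝ} {a b : ℕ}
    (h : ∀ i, a ≤ i → i < b → ε ≤ dist (iter f 0 i x) (iter f 0 i y)) :
    closeFreq f x y ε b ≤ (a : ℝ) / b := by
  rw [closeFreq_eq_card_div]
  refine div_le_div_of_nonneg_right ?_ b.cast_nonneg
  have : (Finset.range b).filter (fun i => dist (iter f 0 i x) (iter f 0 i y) < ε) ⊆
      Finset.range a := by
    intro i hi
    rw [Finset.mem_filter, Finset.mem_range] at hi
    rw [Finset.mem_range]
    by_contra hai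
    exact absurd hi.2 (not_lt.2 (h i (not_lt.1 hai) hi.1))
  have := Finset.card_le_card this
  rw [Finset.card_range] at this
  exact_mod_cast this

/-- The property `p` holds on intervals `[a, b)` with `b / a` arbitrarily large. -/
def HasLongStretches (p : ℕ → Prop) : Prop :=
  ∀ C : ℕ, ∃ a b : ℕ, 0 < a ∧ C * a ≤ b ∧ ∀ i, a ≤ i → i < b → p i

theorem HasLongStretches.frequently {p : ℕ → Prop} (h : HasLongStretches p) :
    ∃ᶠ n in atTop, p n := by
  refine frequently_atTop.2 fun K => ?_
  obtain ⟨a, b, ha, hab, hp⟩ := h (K + 2)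
  have h1 : K + 2 * a ≤ b := by nlinarith
  exact ⟨b - 1, by omega, hp _ (by omega) (by omega)⟩

theorem HasLongStretches.frequently_ratio {p : ℕ → Prop} (h : HasLongStretches p) {η : ℝ}
    (hη : 0 < η) : ∃ᶠ b : ℕ in atTop, 0 < b ∧ ∃ a : ℕ, (a : ℝ) / b ≤ η ∧
      ∀ i, a ≤ i → i < b → p i := by
  refine frequently_atTop.2 fun K => ?_
  obtain ⟨m, hm⟩ := exists_nat_gt (1 / η)
  -- As `0 < a`, the summand `K` makes `b` large, while `m` makes `a / b` at most `η`.
  obtain ⟨a, b, ha, hab, hp⟩ := h (K + m + 1)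
  have hKb : K + 1 ≤ b := by nlinarith
  have hmb : m * a ≤ b := by nlinarith
  refine ⟨b, by omega, by omega, a, ?_, hp⟩
  have hb : (0 : ℝ) < b := by exact_mod_cast (by omega : 0 < b)
  have hmb' : (m : ℝ) * a ≤ b := by exact_mod_cast hmb
  rw [div_le_iff₀ hb]
  have : 1 ≤ η * m := by
    rw [div_lt_iff₀ hη] at hm; linarith
  have ha' : (0 : ℝ) ≤ a := a.cast_nonneg
  nlinarith

theorem limsup_closeFreq_eq_one {ε : ℝ}
    (h : HasLongStretches fun i => dist (iter f 0 i x) (iter f 0 i y) < ε) :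
    limsup (closeFreq f x y ε) atTop = 1 := by
  have hb : IsBoundedUnder (· ≤ ·) atTop (closeFreq f x y ε) :=
    isBoundedUnder_of ⟨1, closeFreq_le_one ε⟩
  have hb' : IsBoundedUnder (· ≥ ·) atTop (closeFreq f x y ε) :=
    isBoundedUnder_of ⟨0, closeFreq_nonneg ε⟩
  refine le_antisymm (limsup_le_of_le hb'.isCoboundedUnder_le
    (Eventually.of_forall (closeFreq_le_one ε))) (le_of_forall_lt_imp_le_of_dense fun c hc => ?_)
  refine le_limsup_of_frequently_le ?_ hb
  refine (h.frequently_ratio (sub_pos.2 hc)).mono fun b hb => ?_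
  obtain ⟨hb, a, ha, hp⟩ := hb
  have := le_closeFreq hb hp
  linarith

theorem liminf_closeFreq_eq_zero {ε : ℝ}
    (h : HasLongStretches fun i => ε ≤ dist (iter f 0 i x) (iter f 0 i y)) :
    liminf (closeFreq f x y ε) atTop = 0 := by
  have hb : IsBoundedUnder (· ≤ ·) atTop (closeFreq f x y ε) :=
    isBoundedUnder_of ⟨1, closeFreq_le_one ε⟩
  have hb' : IsBoundedUnder (· ≥ ·) atTop (closeFreq f x y ε) :=
    isBoundedUnder_of ⟨0, closeFreq_nonneg ε⟩
  refine le_antisymm (le_of_forall_gt_imp_ge_of_dense fun c hc => ?_) (le_liminf_of_le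
    hb.isCoboundedUnder_ge (Eventually.of_forall (closeFreq_nonneg ε)))
  refine liminf_le_of_frequently_le ?_ hb'
  refine (h.frequently_ratio hc).mono fun b hb => ?_
  obtain ⟨_, a, ha, hp⟩ := hb
  exact (closeFreq_le hp).trans ha

theorem liminf_edist_eq_zero
    (h : ∀ ε : ℝ, 0 < ε → HasLongStretches fun i => dist (iter f 0 i x) (iter f 0 i y) < ε) :
    liminf (fun n => edist (iter f 0 n x) (iter f 0 n y)) atTop = 0 := by
  refine le_antisymm (ENNReal.le_of_forall_pos_le_add fun ε hε _ => ?_) zero_le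
  rw [zero_add]
  refine liminf_le_of_frequently_le' ((h ε hε).frequently.mono fun n hn => ?_)
  rw [edist_dist, ← ENNReal.ofReal_coe_nnreal]
  exact ENNReal.ofReal_le_ofReal hn.le

theorem le_limsup_edist {ε : ℝ}
    (h : HasLongStretches fun i => ε ≤ dist (iter f 0 i x) (iter f 0 i y)) :
    ENNReal.ofReal ε ≤ limsup (fun n => edist (iter f 0 n x) (iter f 0 n y)) atTop := by
  refine le_limsup_of_frequently_le' (h.frequently.mono fun n hn => ?_)
  rw [edist_dist]
  exact ENNReal.ofReal_le_ofReal hn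

/-- An uncountable family of pairs of orbits with long stretches of proximity and of separation
yields both kinds of chaos. -/
theorem chaotic_of_hasLongStretches {ι : Type*} [Uncountable ι] {g : ι → X} {δ : ℝ} (hδ : 0 < δ)
    (hclose : ∀ z w, ∀ ε : ℝ, 0 < ε →
      HasLongStretches fun i => dist (iter f 0 i (g z)) (iter f 0 i (g w)) < ε)
    (hfar : ∀ z w, z ≠ w →
      HasLongStretches fun i => δ ≤ dist (iter f 0 i (g z)) (iter f 0 i (g w))) :
    (∃ δ : ℝ, IsLiYorkeChaotic f δ) ∧ IsDistChaotic f := by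
  have hinj : Function.Injective g := by
    intro z w hzw
    by_contra hne
    obtain ⟨n, hn⟩ := (hfar z w hne).frequently.exists
    rw [hzw, dist_self] at hn
    exact absurd hn (not_le.2 hδ)
  have hunc : ¬ (range g).Countable := fun hc => by
    have := hc.to_subtype
    exact not_countable (α := ι) ((Equiv.ofInjective g hinj).injective.countable)
  -- The stretches only give an upper limit of at least `δ`; halving makes the inequality strict.
  refine ⟨⟨δ / 2, half_pos hδ, range g, hunc, ?_⟩, range g, hunc, ?_⟩
  · rintro _ ⟨z, rfl⟩ _ ⟨w, rfl⟩ hne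
    have hzw : z ≠ w := fun h => hne (h ▸ rfl)
    exact ⟨liminf_edist_eq_zero (hclose z w),
      ((ENNReal.ofReal_lt_ofReal_iff hδ).2 (half_lt_self hδ)).trans_le
        (le_limsup_edist (hfar z w hzw))⟩
  · rintro _ ⟨z, rfl⟩ _ ⟨w, rfl⟩ hne
    have hzw : z ≠ w := fun h => hne (h ▸ rfl)
    exact ⟨fun ε hε => limsup_closeFreq_eq_one (hclose z w ε hε), δ, hδ,
      liminf_closeFreq_eq_zero (hfar z w hzw)⟩

end Frequencies

/-! ### Two interlocking periodic words and the scrambled family. -/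

section Horseshoe

variable {N : ℕ} {A : Matrix (Fin N) (Fin N) ℕ}

theorem exists_path (hA : IsTransition A) {k : ℕ} {i j : Fin N} (h : 0 < (A ^ k) i j) :
    ∃ w : ℕ → Fin N, w 0 = i ∧ w k = j ∧ ∀ m < k, A (w m) (w (m + 1)) = 1 := by
  induction k generalizing i with
  | zero =>
    rcases eq_or_ne i j with rfl | hij
    · exact ⟨fun _ => i, rfl, rfl, fun m hm => by omega⟩
    · simp [hij] at h
  | succ k ih =>
    rw [pow_succ', Matrix.mul_apply] at h
    obtain ⟨l, _, hl⟩ := Finset.exists_ne_zero_of_sum_ne_zero h.ne'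
    obtain ⟨h1, h2⟩ := mul_ne_zero_iff.1 hl
    obtain ⟨w, hw0, hwk, hw⟩ := ih (Nat.pos_of_ne_zero h2)
    refine ⟨fun n => Nat.casesOn n i w, rfl, hwk, fun m hm => ?_⟩
    cases m with
    | zero => simpa [hw0] using (hA.2.1 i l).resolve_left h1
    | succ m => exact hw m (by omega)

/-- The edge from `i` to `j` is closed up by a path back from `j` to `i`, and the loop is repeated.
-/
theorem exists_periodic (hA : IsTransition A) (hirr : IsIrred A) {i j : Fin N} (h : A i j = 1) :
    ∃ L : ℕ, 2 ≤ L ∧ ∃ s : SFT A, ∀ k, s.seq (k * L) = i ∧ s.seq (k * L + 1) = j := by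
  obtain ⟨k, hk, hpos⟩ := hirr j i
  obtain ⟨w, hw0, hwk, hw⟩ := exists_path hA hpos
  let u : ℕ → Fin N := fun r => if r = 0 then i else w (r - 1)
  refine ⟨k + 1, by omega, ⟨fun n => u (n % (k + 1)), fun n => ?_⟩, fun q => ⟨?_, ?_⟩⟩
  · have hlt : n % (k + 1) < k + 1 := Nat.mod_lt _ (by omega)
    by_cases hr : n % (k + 1) = k
    · have : (n + 1) % (k + 1) = 0 := by rw [Nat.add_mod, hr, Nat.add_mod_mod]; simp
      rw [hr, this]
      have := hw (k - 1) (by omega)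
      rw [show k - 1 + 1 = k by omega, hwk] at this
      simpa [u, show k ≠ 0 by omega] using this
    · have : (n + 1) % (k + 1) = n % (k + 1) + 1 := by
        rw [Nat.add_mod, Nat.add_mod_mod, Nat.mod_eq_of_lt (by omega)]
      rw [this]
      by_cases h0 : n % (k + 1) = 0
      · simpa [u, h0, hw0] using h
      · have := hw (n % (k + 1) - 1) (by omega)
        rw [show n % (k + 1) - 1 + 1 = n % (k + 1) by omega] at this
        simpa [u, h0] using this
  · simp [u]
  · have : (q * (k + 1) + 1) % (k + 1) = 1 := by
      rw [Nat.add_comm, Nat.add_mul_mod_self_right, Nat.mod_eq_of_lt (by omega)]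
    simp [u, this, hw0]

theorem exists_two_succ (hA : IsTransition A) {i : Fin N} (h : 2 ≤ ∑ j, A i j) :
    ∃ j k, j ≠ k ∧ A i j = 1 ∧ A i k = 1 := by
  have : ∑ j, A i j = (Finset.univ.filter fun j => A i j = 1).card := by
    rw [Finset.card_filter]
    refine Finset.sum_congr rfl fun j _ => ?_
    rcases hA.2.1 i j with h | h <;> simp [h]
  rw [this] at h
  obtain ⟨j, hj, k, hk, hjk⟩ := Finset.one_lt_card.1 h
  exact ⟨j, k, hjk, (Finset.mem_filter.1 hj).2, (Finset.mem_filter.1 hk).2⟩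

theorem exists_two_periodic (hA : IsTransition A) (hirr : IsIrred A)
    (h : ∃ i, 2 ≤ ∑ j, A i j) :
    ∃ L : ℕ, 2 ≤ L ∧ ∃ P Q : SFT A, ∀ k, P.seq (k * L) = Q.seq (k * L) ∧
      P.seq (k * L + 1) ≠ Q.seq (k * L + 1) := by
  obtain ⟨i, hi⟩ := h
  obtain ⟨j, k, hjk, hj, hk⟩ := exists_two_succ hA hi
  obtain ⟨a, ha, P, hP⟩ := exists_periodic hA hirr hj
  obtain ⟨b, hb, Q, hQ⟩ := exists_periodic hA hirr hk
  -- The product of the two periods is a common one.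
  refine ⟨a * b, by nlinarith, P, Q, fun q => ?_⟩
  have h1 := hP (q * b)
  have h2 := hQ (q * a)
  rw [show q * b * a = q * (a * b) by ring] at h1
  rw [show q * a * b = q * (a * b) by ring] at h2
  rw [h1.1, h2.1, h1.2, h2.2]
  exact ⟨rfl, hjk⟩

/-- Follow `Q` on the `p`-th block of length `L` when `x p` holds, and `P` otherwise. -/
def splice {L : ℕ} {P Q : SFT A} (hPQ : ∀ k, P.seq (k * L) = Q.seq (k * L)) (x : ℕ → Bool) :
    SFT A where
  seq n := if x (n / L) then Q.seq n else P.seq n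
  adm n := by
    -- A switch between the words happens only at a multiple of `L`, where they share a letter, so
    -- the transition is admissible.
    have key : ∀ R S : SFT A, L ∣ n + 1 → (∀ k, R.seq (k * L) = S.seq (k * L)) →
        A (R.seq n) (S.seq (n + 1)) = 1 := by
      rintro R S ⟨c, hc⟩ hRS
      rw [hc, mul_comm, ← hRS, mul_comm, ← hc]
      exact R.adm n
    by_cases hd : L ∣ n + 1
    · split_ifs
      · exact Q.adm n
      · exact key Q P hd fun k => (hPQ k).symm
      · exact key P Q hd hPQ
      · exact P.adm n
    · rw [Nat.succ_div_of_not_dvd hd]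
      split_ifs
      · exact Q.adm n
      · exact P.adm n

/-- A binary sequence which on `[2 ^ 2 ^ k, 2 ^ 2 ^ (k + 1))` is constantly `false` for even `k`,
and constantly equal to a letter of `z` for odd `k`, each letter occurring infinitely often. -/
def spread (z : ℕ → Bool) (p : ℕ) : Bool :=
  if Even (Nat.log 2 (Nat.log 2 p)) then false
  else z (Nat.unpair (Nat.log 2 (Nat.log 2 p) / 2)).1

theorem log_log_eq {k p : ℕ} (h1 : 2 ^ 2 ^ k ≤ p) (h2 : p < (2 ^ 2 ^ k) ^ 2) :
    Nat.log 2 (Nat.log 2 p) = k := by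
  rw [← pow_mul, ← pow_succ] at h2
  have hp : p ≠ 0 := by have : 0 < 2 ^ 2 ^ k := by positivity
                        omega
  refine Nat.log_eq_of_pow_le_of_lt_pow ?_ ?_
  · exact Nat.le_log_of_pow_le (by norm_num) h1
  · exact Nat.log_lt_of_lt_pow hp h2

theorem le_two_pow_two_pow (k : ℕ) : k ≤ 2 ^ 2 ^ k :=
  Nat.lt_two_pow_self.le.trans Nat.lt_two_pow_self.le

theorem exists_spread_eq (z w : ℕ → Bool) (K : ℕ) :
    ∃ T ≥ K, ∀ p, T ≤ p → p < T ^ 2 → spread z p = spread w p := by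
  refine ⟨2 ^ 2 ^ (2 * K), le_trans (by omega) (le_two_pow_two_pow _), fun p h1 h2 => ?_⟩
  simp [spread, log_log_eq h1 h2]

theorem exists_spread_ne {z w : ℕ → Bool} (h : z ≠ w) (K : ℕ) :
    ∃ T ≥ K, ∀ p, T ≤ p → p < T ^ 2 → spread z p ≠ spread w p := by
  obtain ⟨j, hj⟩ := Function.ne_iff.1 h
  have hK := Nat.right_le_pair j K
  -- This interval displays the letter `j`, where `z` and `w` differ; varying `K` in the pairing
  -- gives such intervals arbitrarily far out.
  refine ⟨2 ^ 2 ^ (2 * Nat.pair j K + 1), le_trans (by omega) (le_two_pow_two_pow _),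
    fun p h1 h2 => ?_⟩
  have hodd : ¬ Even (2 * Nat.pair j K + 1) := by simp
  have hdiv : (2 * Nat.pair j K + 1) / 2 = Nat.pair j K := by omega
  rw [spread, spread, log_log_eq h1 h2, if_neg hodd, if_neg hodd, hdiv, Nat.unpair_pair]
  exact hj

variable {X : Type*} [MetricSpace X] {f : ℕ → X → X} {π : ℕ → SFT A → X}

theorem IsCoding.chaotic (hπ : IsCoding f A π) (hA : IsTransition A) (hirr : IsIrred A)
    (h : ∃ i, 2 ≤ ∑ j, A i j) : (∃ δ : ℝ, IsLiYorkeChaotic f δ) ∧ IsDistChaotic f := by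
  obtain ⟨L, hL, P, Q, hPQ⟩ := exists_two_periodic hA hirr h
  obtain ⟨δ, hδ, hfar⟩ := hπ.exists_le_dist (L + 1)
  have hL0 : 0 < L := by omega
  have : Uncountable (ℕ → Bool) := by
    rw [← Cardinal.aleph0_lt_mk_iff]
    simpa using Cardinal.cantor Cardinal.aleph0
  refine chaotic_of_hasLongStretches
    (g := fun z : ℕ → Bool => π 0 (splice (fun k => (hPQ k).1) (spread z))) hδ ?_ ?_
  · intro z w ε hε C
    obtain ⟨m, hm⟩ := hπ.exists_agree hε
    obtain ⟨T, hT, heq⟩ := exists_spread_eq z w (C + m + 1)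
    -- Proximity at time `i` needs agreement of the `m` letters from `i` on, so the stretch stops
    -- `m` short of the end of the blocks.
    refine ⟨L * T, L * T ^ 2 - m, Nat.mul_pos hL0 (by omega), ?_, fun i h1 h2 => ?_⟩
    · refine Nat.le_sub_of_add_le ?_
      have h1 : (C + m + 1) * (L * T) ≤ T * (L * T) := Nat.mul_le_mul_right _ hT
      have h2 : 1 ≤ L * T := Nat.mul_pos hL0 (by omega)
      nlinarith
    · beta_reduce
      rw [hπ.iter_eq, hπ.iter_eq]
      refine hm _ _ _ fun k hk => ?_
      rw [shift_iterate_seq, shift_iterate_seq]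
      have hb : spread z ((i + k) / L) = spread w ((i + k) / L) := by
        refine heq _ ((Nat.le_div_iff_mul_le hL0).2 ?_) ((Nat.div_lt_iff_lt_mul hL0).2 ?_)
        · rw [mul_comm]; omega
        · rw [mul_comm]; omega
      simp only [splice, hb]
  · intro z w hzw C
    obtain ⟨T, hT, hne⟩ := exists_spread_ne hzw (C + 1)
    -- The disagreement is read off in the block after that of `i`, so the last block is left out.
    refine ⟨L * T, L * (T ^ 2 - 1), Nat.mul_pos hL0 (by omega), ?_, fun i h1 h2 => ?_⟩
    · rw [mul_left_comm]
      refine Nat.mul_le_mul_left _ (Nat.le_sub_of_add_le ?_)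
      nlinarith
    · beta_reduce
      rw [hπ.iter_eq, hπ.iter_eq]
      have hq1 : T ≤ i / L := (Nat.le_div_iff_mul_le hL0).2 (by rwa [mul_comm])
      have hq2 : i / L < T ^ 2 - 1 := (Nat.div_lt_iff_lt_mul hL0).2 (by rwa [mul_comm])
      have hdm := Nat.div_add_mod i L
      have hml := Nat.mod_lt i hL0
      -- The second letter of the next block, where `P` and `Q` differ, is at most `L + 1` places
      -- after `i`; hence the choice of `δ`.
      have hpos : i + (L + 1 - i % L) = (i / L + 1) * L + 1 := by
        rw [add_mul, mul_comm (i / L)]; omega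
      refine hfar _ _ _ (L + 1 - i % L) (by omega) ?_
      rw [shift_iterate_seq, shift_iterate_seq, hpos]
      have hdiv : ((i / L + 1) * L + 1) / L = i / L + 1 := by
        rw [Nat.add_comm, Nat.add_mul_div_right _ _ hL0, Nat.div_eq_of_lt (by omega), zero_add]
      have hb := hne (i / L + 1) (by omega) (by omega)
      have hPQ' := (hPQ (i / L + 1)).2
      simp only [splice, hdiv]
      revert hb
      cases spread z (i / L + 1) <;> cases spread w (i / L + 1) <;> simp [hPQ', hPQ'.symm]

end Horseshoe

end NDS

theorem theorem3p6 {X : Type*} [MetricSpace X] (f : ℕ → X → X)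
    {N : ℕ} (A : Matrix (Fin N) (Fin N) ℕ) (hA : NDS.IsTransition A)
    (V : Fin N → Set X) (hV : ∀ i, (V i).Nonempty)
    (hVd : ∀ i j, i ≠ j → 0 < NDS.setDist (V i) (V j))
    (W : Fin N → ℕ → Set X)
    (hWne : ∀ i n, (W i n).Nonempty) (hWc : ∀ i n, IsCompact (W i n))
    (hWV : ∀ i n, W i n ⊆ V i)
    (hf : NDS.EquiContinuous (fun n => (⋃ (k : ℕ) (i : Fin N), W i k).domRestrict (f n)))
    (H1 : ∀ (m n : ℕ) (α : NDS.SFT A), (NDS.cyl f W α m n).Nonempty)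
    (H2 : ∀ α : NDS.SFT A, ∀ ε : ℝ, 0 < ε → ∃ M : ℕ, ∀ m ≥ M, ∀ n : ℕ,
      Metric.diam (NDS.cyl f W α m n) < ε) :
    (∃ Λ : ℕ → Set X,
      (∀ n, (Λ n).Nonempty ∧ IsCompact (Λ n) ∧ Λ n ⊆ ⋃ i, W i n) ∧
      (∀ n, f n '' Λ n = Λ (n + 1)) ∧
      NDS.EquiConjugate f Λ (fun _ => NDS.shift A) (fun _ => Set.univ) ∧
      (CompactSpace X →
        Filter.Tendsto (NDS.normRoot A) Filter.atTop (nhds (NDS.rho A)) ∧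
        0 < NDS.rho A ∧
        NDS.topEntropy f (Λ 0) = ((Real.log (NDS.rho A) : ℝ) : EReal))) ∧
    (NDS.IsIrred A → (∃ i₀, 2 ≤ ∑ j, A i₀ j) →
      (∃ δ : ℝ, NDS.IsLiYorkeChaotic f δ) ∧ NDS.IsDistChaotic f) := by
  obtain ⟨π, hπW, hπ⟩ := NDS.exists_coding f V hVd W hWc hWV hf H1 H2
  refine ⟨⟨fun n => Set.range (π n), fun n => ⟨?_, ?_, ?_⟩, hπ.image_range hA,
    hπ.equiConjugate, fun _ => ?_⟩, hπ.chaotic hA⟩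
  · have := hA.nonempty
    exact Set.range_nonempty _
  · exact isCompact_range (hπ.continuous n)
  · rintro _ ⟨α, rfl⟩
    exact Set.mem_iUnion.2 ⟨_, hπW n α⟩
  · obtain ⟨h1, h2, _⟩ := NDS.tendsto_normRoot hA
    exact ⟨h1, h2, hπ.topEntropy_eq hA⟩
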